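/- Let $\mathbb X$ be a measurable space, $H$ a probability measure on $\mathbb X$, and $\alpha,\tau,\phi>0$. For $\sigma>0$ let $\Gamma(\alpha,\sigma,H)$ denote the law of the gamma process, i.e. of the random measure $\sum_{k\ge1}w_k\delta_{X_k}$ on $\mathbb X$, where the set of masses $\{w_k\}$ is a Poisson process on $(0,\infty)$ with intensity $\alpha w^{-1}e^{-\sigma w}\,dw$ and the $X_k$ are iid with law $H$, independent of the masses. Write $\mathrm{Gam}(a,b)$ for the gamma distribution with shape $a$ and rate $b$, with $\mathrm{Gam}(0,b)=\delta_0$. Let $G$ be a random measure on $\mathbb X$ with law $\Gamma(\alpha,\tau,H)$, written almost surely as $G=\sum_{k\ge1}w_k\delta_{X_k}$ with random variables $w_k\ge0$ and $X_k\in\mathbb X$. Let $(c_k)_{k\ge1}$ be, conditionally on $(w_j,X_j)_{j\ge1}$, independent with $c_k\sim\mathrm{Poisson}(\phi w_k)$, and put $C=\sum_{k\ge1}c_k\delta_{X_k}$. Then the conditional law of $G$ given $C$ is the law of $$G^*+\sum_{k\ge1}w_k^*\,\delta_{X_k},$$ where, conditionally, $G^*$ and $w_1^*,w_2^*,\dots$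 are mutually independent, $G^*\sim\Gamma(\alpha,\tau+\phi,H)$ and $w_k^*\sim\mathrm{Gam}(c_k,\tau+\phi)$. That is, $\Gamma(\alpha,\tau+\phi,H)$ exists, and for every measurable set $B$ of measures, $P(G\in B\mid C)$ is almost surely equal to the probability that this random measure lies in $B$, computed with the realized values of $(c_k,X_k)_{k\ge1}$ held fixed. -/

import Mathlib

open MeasureTheory ProbabilityTheory
open scoped ENNReal NNReal

noncomputable section

/-- `N` is a Poisson process with intensity measure `Λ` on the probability space `(Ω, P)`: a random
measure with independent values on disjoint sets and with `N(A)` Poisson distributed with mean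
`Λ(A)` whenever `Λ(A)` is finite. -/
structure IsPoissonProcess {Ω E : Type*} [MeasurableSpace Ω] [MeasurableSpace E]
    (N : Ω → Measure E) (Λ : Measure E) (P : Measure Ω) : Prop where
  measurable : Measurable N
  law : ∀ A : Set E, MeasurableSet A → Λ A ≠ ∞ →
    P.map (fun ω => N ω A) = (poissonMeasure (Λ A).toNNReal).map (fun n : ℕ => (n : ℝ≥0∞))
  indep : ∀ (n : ℕ) (A : Fin n → Set E), (∀ i, MeasurableSet (A i)) →
    Pairwise (fun i j => Disjoint (A i) (A j)) → iIndepFun (fun i ω => N ω (A i)) P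

/-- The Lévy measure `α w⁻¹ e^{-τ w} dw` on `(0, ∞)`, as a measure on `ℝ`. -/
def gammaLevyMeasure (α τ : ℝ) : Measure ℝ :=
  (volume.restrict (Set.Ioi (0 : ℝ))).withDensity
    (fun w => ENNReal.ofReal (α * w⁻¹ * Real.exp (-(w * τ))))

/-- The atomic measure `∑ₖ wₖ δ_{Xₖ}` with nonnegative masses `wₖ`. -/
def atomicMeasure {𝕏 : Type*} [MeasurableSpace 𝕏] (w : ℕ → ℝ) (X : ℕ → 𝕏) : Measure 𝕏 :=
  Measure.sum (fun k => ENNReal.ofReal (w k) • Measure.dirac (X k))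

/-- The atomic measure depends measurably on its masses and its atom locations. -/
theorem measurable_atomicMeasure {𝕏 : Type*} [MeasurableSpace 𝕏] :
    Measurable (fun p : (ℕ → ℝ) × (ℕ → 𝕏) => atomicMeasure p.1 p.2) := by
  refine Measure.measurable_of_measurable_coe _ (fun A hA => ?_)
  have h : (fun p : (ℕ → ℝ) × (ℕ → 𝕏) => atomicMeasure p.1 p.2 A) =
      fun p => ∑' k, ENNReal.ofReal (p.1 k) * A.indicator 1 (p.2 k) := by
    funext p
    simp [atomicMeasure, Measure.sum_apply _ hA, Measure.dirac_apply' _ hA]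
  rw [h]
  refine Measurable.tsum (fun k => Measurable.mul (by fun_prop) ?_)
  exact (measurable_one.indicator hA).comp (by fun_prop)

/-- The probability measure `Q` on the space of measures on `𝕏` is the law `Γ(α, τ, H)` of the gamma
process: `Q` is the law of `∑ₖ wₖ δ_{Xₖ}`, where the set of masses `{wₖ}` is a Poisson process on
`(0, ∞)` with intensity `α w⁻¹ e^{-τ w} dw`, and the `Xₖ` are iid with law `H` and independent of the
masses. -/
def IsGammaProcessLaw {𝕏 : Type*} [MeasurableSpace 𝕏] (α τ : ℝ) (H : Measure 𝕏)
    (Q : Measure (Measure 𝕏)) : Prop :=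
  ∃ ν : Measure (ℕ → ℝ), IsProbabilityMeasure ν ∧
    IsPoissonProcess (fun w : ℕ → ℝ => Measure.sum (fun k => Measure.dirac (w k)))
      (gammaLevyMeasure α τ) ν ∧
    Q = (ν.prod (Measure.infinitePi (fun _ : ℕ => H))).map (fun p => atomicMeasure p.1 p.2)

/-- The gamma distribution with shape `a ≥ 0` and rate `r`; it is degenerate at `0` for `a = 0`. -/
def gammaLaw (a r : ℝ) : Measure ℝ :=
  if a = 0 then Measure.dirac 0 else gammaMeasure a r

/-- The conditional law of `Y` given the σ-algebra `𝒢` is the random probability measure `Q`: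
`P(Y ∈ B | 𝒢) = Q(B)` almost surely, for every measurable set `B`. -/
def IsCondLaw {Ω E : Type*} [MeasurableSpace E] {mΩ : MeasurableSpace Ω} (P : Measure Ω)
    (𝒢 : MeasurableSpace Ω) (Y : Ω → E) (Q : Ω → Measure E) : Prop :=
  (∀ ω, IsProbabilityMeasure (Q ω)) ∧
    ∀ B : Set E, MeasurableSet B → P⟦Y ⁻¹' B | 𝒢⟧ =ᵐ[P] fun ω => (Q ω).real B

end

/-! Everything is computed with Laplace functionals. Given masses and atoms, the Poisson counts
satisfy `E e^{-∫ s dC} = e^{-∫ φ(1 - e^{-s}) dG}`, so the joint functional of `(C, G)` at `(s, f)`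
is that of the gamma process at `f + φ(1 - e^{-s})`, namely `exp(-∫ α log(1 + (f + φ(1 - e^{-s}))/τ)
dH)`.

The candidate posterior has functional `exp(-∫ α log(1 + f/(τ+φ)) dH) · exp(-∫ log(1 + f/(τ+φ))
dC)`. Weighting it by `e^{-∫ s dC}` and averaging calls for the functional of `C` alone at `s +
log(1 + f/(τ+φ))`, which is the joint formula again with second argument `0`. The two results agree
by the identity `log_gamma_poisson_conjugate`. Hence `(C, G)` has the same law as `C` paired with a
draw from the candidate, which is the defining property of a conditional law.

Two facts make this rigorous on an arbitrary measurable space. Laplace functionals determine joint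
laws of random measures (`measure_prod_eq_of_laplace`), and measurability of a family of laws can be
tested on them (`measurable_of_laplace`). The second shows that the candidate is `σ(C)`-measurable,
although the labelled list of pairs `(c_k, X_k)` need not be recoverable from `C`. Both rest on
Stone–Weierstrass. -/

noncomputable section

/-! ### The exponential on `[0, ∞]` and Laplace transforms of independent series. -/

/-- The function `x ↦ e^{-x}` on `[0, ∞]`. -/
def expNeg (x : ℝ≥0∞) : ℝ≥0∞ := EReal.exp (-(x : EReal))

/-- The inverse `y ↦ -log y` of `expNeg`, truncated at `0`. -/
def negLog (y : ℝ≥0∞) : ℝ≥0∞ := (-(ENNReal.log y)).toENNReal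

lemma negLog_expNeg (x : ℝ≥0∞) : negLog (expNeg x) = x := by
  simp [negLog, expNeg]

lemma expNeg_negLog {y : ℝ≥0∞} (hy : y ≤ 1) : expNeg (negLog y) = y := by
  have : 0 ≤ -(ENNReal.log y) := by
    rw [EReal.le_neg, neg_zero]
    exact ENNReal.log_le_zero_iff.2 hy
  rw [expNeg, negLog, EReal.coe_toENNReal this, neg_neg, ENNReal.exp_log]

@[simp] lemma expNeg_zero : expNeg 0 = 1 := by simp [expNeg]

@[simp] lemma expNeg_top : expNeg ∞ = 0 := by simp [expNeg]

lemma expNeg_le_one (x : ℝ≥0∞) : expNeg x ≤ 1 := by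
  rw [expNeg, EReal.exp_le_one_iff, EReal.neg_le, neg_zero]
  exact EReal.coe_ennreal_nonneg x

lemma expNeg_ne_top (x : ℝ≥0∞) : expNeg x ≠ ∞ := ((expNeg_le_one x).trans_lt ENNReal.one_lt_top).ne

lemma expNeg_antitone : Antitone expNeg := fun x y h => by
  rw [expNeg, expNeg, EReal.exp_le_exp_iff, EReal.neg_le_neg_iff]
  exact_mod_cast h

lemma expNeg_add (x y : ℝ≥0∞) : expNeg (x + y) = expNeg x * expNeg y := by
  rw [expNeg, expNeg, expNeg, ← EReal.exp_add, EReal.coe_ennreal_add, EReal.neg_add, sub_eq_add_neg]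
  · left; exact EReal.coe_ennreal_ne_bot x
  · right; exact EReal.coe_ennreal_ne_bot y

lemma continuous_expNeg : Continuous expNeg := by
  unfold expNeg
  exact ENNReal.continuous_exp.comp (continuous_neg.comp continuous_coe_ennreal_ereal)

@[fun_prop]
lemma measurable_expNeg : Measurable expNeg := continuous_expNeg.measurable

@[fun_prop]
lemma measurable_negLog : Measurable negLog := by
  unfold negLog
  fun_prop

lemma expNeg_ofReal {x : ℝ} (hx : 0 ≤ x) : expNeg (ENNReal.ofReal x) = ENNReal.ofReal (Real.exp (-x)) := by
  rw [expNeg, EReal.coe_ennreal_ofReal, max_eq_left hx, ← EReal.coe_neg, EReal.exp_coe]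

lemma expNeg_sum {ι : Type*} (s : Finset ι) (f : ι → ℝ≥0∞) :
    expNeg (∑ i ∈ s, f i) = ∏ i ∈ s, expNeg (f i) := by
  classical
  induction s using Finset.induction_on with
  | empty => simp
  | insert a s ha ih => rw [Finset.sum_insert ha, Finset.prod_insert ha, expNeg_add, ih]

lemma expNeg_natCast_mul (n : ℕ) (x : ℝ≥0∞) : expNeg (n * x) = expNeg x ^ n := by
  have := expNeg_sum (Finset.range n) (fun _ => x)
  simpa using this

lemma tendsto_expNeg_tsum (a : ℕ → ℝ≥0∞) :
    Filter.Tendsto (fun n => ∏ k ∈ Finset.range n, expNeg (a k)) Filter.atTop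
      (nhds (expNeg (∑' k, a k))) := by
  simp_rw [← expNeg_sum]
  exact (continuous_expNeg.tendsto _).comp ENNReal.summable.hasSum.tendsto_sum_nat

/-- The Laplace transform of a series of independent nonnegative random variables. -/
lemma lintegral_infinitePi_expNeg_tsum {F : ℕ → Type*} [∀ k, MeasurableSpace (F k)]
    (μ : ∀ k, Measure (F k)) [∀ k, IsProbabilityMeasure (μ k)] (h : ∀ k, F k → ℝ≥0∞)
    (hh : ∀ k, Measurable (h k)) :
    ∫⁻ x, expNeg (∑' k, h k (x k)) ∂(Measure.infinitePi μ) =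
      expNeg (∑' k, negLog (∫⁻ y, expNeg (h k y) ∂(μ k))) := by
  have h1 : ∀ k, ∫⁻ y, expNeg (h k y) ∂(μ k) ≤ 1 := fun k => by
    calc _ ≤ ∫⁻ y, 1 ∂(μ k) := lintegral_mono fun y => expNeg_le_one _
      _ = 1 := by simp
  have hfin : ∀ n, ∫⁻ x, ∏ k ∈ Finset.range n, expNeg (h k (x k)) ∂(Measure.infinitePi μ) =
      ∏ k ∈ Finset.range n, ∫⁻ y, expNeg (h k y) ∂(μ k) := by
    intro n
    have hind : iIndepFun (fun k (x : ∀ k, F k) => expNeg (h k (x k))) (Measure.infinitePi μ) :=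
      iIndepFun_infinitePi (X := fun k y => expNeg (h k y)) (fun k => by fun_prop)
    rw [lintegral_prod_eq_prod_lintegral_of_indepFun _ _ hind (fun k => by fun_prop)]
    refine Finset.prod_congr rfl fun k _ => ?_
    exact (measurePreserving_eval_infinitePi μ k).lintegral_comp (f := fun y => expNeg (h k y))
      (by fun_prop)
  have hlim := tendsto_lintegral_of_dominated_convergence (μ := Measure.infinitePi μ)
    (F := fun n x => ∏ k ∈ Finset.range n, expNeg (h k (x k)))
    (f := fun x => expNeg (∑' k, h k (x k))) (fun _ => 1) (fun n => by fun_prop)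
    (fun n => Filter.Eventually.of_forall fun x => Finset.prod_le_one' fun k _ => expNeg_le_one _)
    (by simp) (Filter.Eventually.of_forall fun x => tendsto_expNeg_tsum _)
  -- `negLog` rewrites the infinite product of the individual transforms as `expNeg` of a series, so
  -- both sides are limits of the same finite products.
  refine tendsto_nhds_unique hlim ?_
  simp_rw [hfin]
  convert tendsto_expNeg_tsum (fun k => negLog (∫⁻ y, expNeg (h k y) ∂(μ k))) using 4 with n k
  rw [expNeg_negLog (h1 _)]

/-! ### Mixed moments control measurability and uniqueness of laws. -/

/-- If all mixed moments of a family of probability measures on a finite cube depend measurably on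
the parameter, then so do the measures. -/
lemma measurable_measure_cube_of_monomials {T I : Type*} [MeasurableSpace T] [Fintype I]
    (ρ : T → Measure (I → unitInterval)) [∀ t, IsProbabilityMeasure (ρ t)]
    (h : ∀ l : List I, Measurable fun t => ∫ x, (l.map fun i => (x i : ℝ)).prod ∂(ρ t)) :
    Measurable ρ := by
  let K := I → unitInterval
  have hint : ∀ (g : C(K, ℝ)) t, Integrable g (ρ t) := fun g t =>
    (BoundedContinuousFunction.mkOfCompact g).integrable _
  -- `V` contains the monomials in the coordinates, hence the algebra they generate. Pointwise
  -- limits of measurable functions are measurable, so density of that algebra gives `V = C(K, ℝ)`.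
  let V : Submodule ℝ C(K, ℝ) :=
    { carrier := {g | Measurable fun t => ∫ x, g x ∂(ρ t)}
      add_mem' := fun {f g} hf hg => by
        have : (fun t => ∫ x, (f + g) x ∂(ρ t)) =
            fun t => ∫ x, f x ∂(ρ t) + ∫ x, g x ∂(ρ t) := by
          funext t
          exact integral_add (hint f t) (hint g t)
        rw [Set.mem_ofPred_eq, this]
        exact Measurable.add hf hg
      zero_mem' := by simp
      smul_mem' := fun c f hf => by
        have : (fun t => ∫ x, (c • f) x ∂(ρ t)) = fun t => c * ∫ x, f x ∂(ρ t) := by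
          funext t
          exact integral_const_mul c _
        rw [Set.mem_ofPred_eq, this]
        exact Measurable.const_mul hf c }
  let coord : I → C(K, ℝ) := fun i => ⟨fun x => (x i : ℝ), by fun_prop⟩
  let A : Subalgebra ℝ C(K, ℝ) := Algebra.adjoin ℝ (Set.range coord)
  have hAV : Subalgebra.toSubmodule A ≤ V := by
    rw [Algebra.adjoin_eq_span, Submodule.span_le]
    intro g hg
    obtain ⟨l, hl, rfl⟩ := Submonoid.exists_list_of_mem_closure hg
    obtain ⟨l', rfl⟩ : ∃ l' : List I, l'.map coord = l := by
      have : l ∈ Set.range (List.map coord) := by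
        rw [Set.range_list_map]
        exact hl
      exact this
    have : ∀ x, (l'.map coord).prod x = (l'.map fun i => (x i : ℝ)).prod := by
      intro x
      induction l' with
      | nil => simp
      | cons a l ih =>
        simp only [List.map_cons, List.prod_cons, ContinuousMap.mul_apply]
        rw [ih]
        · rfl
        · intro y hy; exact hl y (by simp [hy])
        · exact Submonoid.list_prod_mem _ fun y hy => Submonoid.subset_closure (hl y (by simp [hy]))
    change Measurable fun t => ∫ x, (l'.map coord).prod x ∂(ρ t)
    simp_rw [this]
    exact h l'
  have hsep : A.SeparatesPoints := by
    intro x y hxy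
    obtain ⟨i, hi⟩ := Function.ne_iff.1 hxy
    refine ⟨coord i, ⟨coord i, Algebra.subset_adjoin ⟨i, rfl⟩, rfl⟩, fun h => hi ?_⟩
    exact Subtype.ext h
  have hV : ∀ g : C(K, ℝ), Measurable fun t => ∫ x, g x ∂(ρ t) := by
    intro g
    have hg : g ∈ A.topologicalClosure := by
      rw [ContinuousMap.subalgebra_topologicalClosure_eq_top_of_separatesPoints A hsep]
      trivial
    obtain ⟨u, hu, hug⟩ := mem_closure_iff_seq_limit.1 hg
    refine measurable_of_tendsto_metrizable (f := fun n t => ∫ x, u n x ∂(ρ t))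
      (fun n => hAV (hu n)) ?_
    rw [tendsto_pi_nhds]
    intro t
    have hcont : Continuous fun g : C(K, ℝ) => ∫ x, g x ∂(ρ t) := by
      refine (LipschitzWith.of_dist_le_mul (K := 1) fun f g => ?_).continuous
      rw [dist_eq_norm, ← integral_sub (hint f t) (hint g t), NNReal.coe_one, one_mul]
      refine (norm_integral_le_of_norm_le_const (C := dist f g)
        (Filter.Eventually.of_forall fun x => ?_)).trans (by simp)
      rw [← dist_eq_norm]
      exact ContinuousMap.dist_apply_le_dist x
    exact (hcont.tendsto g).comp hug
  refine Measurable.measure_of_isPiSystem_of_isProbabilityMeasure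
    (BorelSpace.measurable_eq.trans borel_eq_generateFrom_isClosed) isPiSystem_isClosed ?_
  intro F hF
  -- Closed sets form a generating π-system, and their indicators are limits of continuous thickened
  -- indicators.
  have hδ : ∀ n : ℕ, (0 : ℝ) < 1 / (n + 1) := fun n => by positivity
  refine measurable_of_tendsto_metrizable
    (f := fun n t => ∫⁻ x, (thickenedIndicator (hδ n) F x : ℝ≥0∞) ∂(ρ t)) (fun n => ?_) ?_
  · let g : C(K, ℝ) := ⟨fun x => (thickenedIndicator (hδ n) F x : ℝ), by fun_prop⟩
    have : (fun t => ∫⁻ x, (thickenedIndicator (hδ n) F x : ℝ≥0∞) ∂(ρ t)) =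
        fun t => ENNReal.ofReal (∫ x, g x ∂(ρ t)) := by
      funext t
      rw [ofReal_integral_eq_lintegral_ofReal (hint g t)
        (Filter.Eventually.of_forall fun x => NNReal.coe_nonneg _)]
      exact lintegral_congr fun x => ENNReal.ofReal_coe_nnreal.symm
    rw [this]
    exact (hV g).ennreal_ofReal
  · rw [tendsto_pi_nhds]
    exact fun t => tendsto_lintegral_thickenedIndicator_of_isClosed (ρ t) hF hδ
      tendsto_one_div_add_atTop_nhds_zero_nat

/-- If a family of `[0, 1]`-valued functions generates the σ-algebra, and all their mixed moments
under a family of probability measures depend measurably on the parameter, then so do the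
measures. -/
lemma measurable_measure_of_monomials {T E ι : Type*} [MeasurableSpace T] [mE : MeasurableSpace E]
    (ev : E → ι → unitInterval) (hev : Measurable ev)
    (hgen : mE ≤ MeasurableSpace.comap ev inferInstance)
    (ρ : T → Measure E) [∀ t, IsProbabilityMeasure (ρ t)]
    (h : ∀ l : List ι, Measurable fun t => ∫ x, (l.map fun i => (ev x i : ℝ)).prod ∂(ρ t)) :
    Measurable ρ := by
  -- The index set may be uncountable, where the Borel and product σ-algebras of the cube can
  -- differ. Cylinders reduce the claim to finite cubes.
  have hgen' : mE = MeasurableSpace.generateFrom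
      (Set.preimage ev '' measurableCylinders fun _ : ι => unitInterval) := by
    rw [← MeasurableSpace.comap_generateFrom, generateFrom_measurableCylinders]
    exact le_antisymm hgen hev.comap_le
  refine Measurable.measure_of_isPiSystem_of_isProbabilityMeasure hgen'
    (isPiSystem_measurableCylinders.comap ev) ?_
  rintro _ ⟨S, hS, rfl⟩
  obtain ⟨s, S, hSm, rfl⟩ := (mem_measurableCylinders _).1 hS
  have hr : Measurable fun x => s.restrict (ev x) := (Finset.measurable_restrict s).comp hev
  have hρ : Measurable fun t => (ρ t).map fun x => s.restrict (ev x) := by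
    have : ∀ t, IsProbabilityMeasure ((ρ t).map fun x => s.restrict (ev x)) := fun t =>
      Measure.isProbabilityMeasure_map hr.aemeasurable
    refine measurable_measure_cube_of_monomials _ fun l => ?_
    convert h (l.map (fun i => (i : ι))) using 2 with t
    rw [integral_map hr.aemeasurable]
    · simp
    · refine Continuous.aestronglyMeasurable ?_
      exact continuous_list_prod l fun i _ => by fun_prop
  convert (Measure.measurable_coe hSm).comp hρ using 2 with t
  rw [Function.comp_apply, Measure.map_apply hr hSm]
  rfl

/-- Two probability measures agree if a generating family of `[0, 1]`-valued functions has the same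
mixed moments under both. -/
lemma measure_eq_of_monomials {E ι : Type*} [mE : MeasurableSpace E]
    (ev : E → ι → unitInterval) (hev : Measurable ev)
    (hgen : mE ≤ MeasurableSpace.comap ev inferInstance)
    (μ ν : Measure E) [IsProbabilityMeasure μ] [IsProbabilityMeasure ν]
    (h : ∀ l : List ι, ∫ x, (l.map fun i => (ev x i : ℝ)).prod ∂μ =
      ∫ x, (l.map fun i => (ev x i : ℝ)).prod ∂ν) : μ = ν := by
  let ρ : Bool → Measure E := fun b => bif b then μ else ν
  have : ∀ b, IsProbabilityMeasure (ρ b) := by rintro (_ | _) <;> assumption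
  -- Uniqueness is measurability over the trivial σ-algebra on `Bool`: a measurable numerical
  -- function there is constant, so `ρ true` and `ρ false` agree on every `B`.
  have hρ := @measurable_measure_of_monomials Bool E ι ⊥ mE ev hev hgen ρ _ fun l => by
    have : (fun t => ∫ x, (l.map fun i => (ev x i : ℝ)).prod ∂(ρ t)) =
        fun _ => ∫ x, (l.map fun i => (ev x i : ℝ)).prod ∂μ := by
      funext b
      cases b
      · exact (h l).symm
      · rfl
    rw [this]
    exact @measurable_const _ _ _ ⊥ _
  ext B hB
  have hm : @Measurable Bool ℝ≥0∞ ⊥ _ fun b => ρ b B := (Measure.measurable_coe hB).comp hρ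
  rcases MeasurableSpace.measurableSet_bot_iff.1 (hm (measurableSet_singleton (μ B))) with h0 | h0
  · have : true ∈ (fun b => ρ b B) ⁻¹' {μ B} := rfl
    rw [h0] at this
    exact this.elim
  · have : false ∈ (fun b => ρ b B) ⁻¹' {μ B} := by rw [h0]; trivial
    exact (Set.mem_singleton_iff.1 this).symm

/-! ### Laplace functionals determine laws of random measures. -/

/-- The values `e^{-m(A)}` of a measure `m` on measurable sets `A`. -/
def expNegEval {𝕏 : Type*} [MeasurableSpace 𝕏] (m : Measure 𝕏) (A : {A : Set 𝕏 // MeasurableSet A}) :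
    unitInterval :=
  ⟨(expNeg (m A)).toReal, ENNReal.toReal_nonneg,
    ENNReal.toReal_le_of_le_ofReal zero_le_one (by simpa using expNeg_le_one _)⟩

lemma measurable_expNegEval {𝕏 : Type*} [MeasurableSpace 𝕏] :
    Measurable (expNegEval (𝕏 := 𝕏)) := by
  refine measurable_pi_iff.2 fun A => Measurable.subtype_mk ?_
  exact (measurable_expNeg.comp (Measure.measurable_coe A.2)).ennreal_toReal

/-- `negLog` inverts `expNeg` on all of `[0, ∞]`, so each evaluation `m A` is recovered, infinite
values included; no finiteness of the measures is needed. -/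
lemma measurableSpace_measure_le_comap_expNegEval {𝕏 : Type*} [MeasurableSpace 𝕏] :
    (inferInstance : MeasurableSpace (Measure 𝕏)) ≤
      MeasurableSpace.comap (expNegEval (𝕏 := 𝕏)) inferInstance := by
  refine iSup₂_le fun A hA => ?_
  let k : ({A : Set 𝕏 // MeasurableSet A} → unitInterval) → ℝ≥0∞ :=
    fun y => negLog (ENNReal.ofReal (y ⟨A, hA⟩ : ℝ))
  have hk : Measurable k := by fun_prop
  have : (fun m : Measure 𝕏 => m A) = k ∘ expNegEval := by
    funext m
    simp [k, expNegEval, ENNReal.ofReal_toReal (expNeg_ne_top _), negLog_expNeg]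
  rw [this, ← MeasurableSpace.comap_comp]
  exact MeasurableSpace.comap_mono hk.comap_le

/-- A product of factors `e^{-m(A)}` is a Laplace functional, taken at the sum of the indicators of
the sets `A`. This translates mixed moments into Laplace functionals. -/
lemma exists_prod_expNegEval {𝕏 : Type*} [MeasurableSpace 𝕏]
    (l : List {A : Set 𝕏 // MeasurableSet A}) :
    ∃ f : 𝕏 → ℝ, Measurable f ∧ (∀ x, 0 ≤ f x) ∧ ∀ m : Measure 𝕏,
      (l.map fun A => (expNegEval m A : ℝ)).prod =
        (expNeg (∫⁻ x, ENNReal.ofReal (f x) ∂m)).toReal := by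
  induction l with
  | nil => exact ⟨0, measurable_zero, by simp, by simp⟩
  | cons A l ih =>
    obtain ⟨f, hf, hf0, h⟩ := ih
    have hA : ∀ x, 0 ≤ A.1.indicator (1 : 𝕏 → ℝ) x := fun x =>
      Set.indicator_nonneg (fun _ _ => zero_le_one) x
    refine ⟨fun x => A.1.indicator 1 x + f x, (measurable_one.indicator A.2).add hf,
      fun x => add_nonneg (hA x) (hf0 x), fun m => ?_⟩
    rw [List.map_cons, List.prod_cons, h m]
    simp_rw [ENNReal.ofReal_add (hA _) (hf0 _)]
    rw [lintegral_add_right _ (by fun_prop), expNeg_add, ENNReal.toReal_mul]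
    have : (fun x => ENNReal.ofReal (A.1.indicator (1 : 𝕏 → ℝ) x)) = A.1.indicator 1 := by
      funext x
      by_cases hx : x ∈ A.1 <;> simp [hx]
    rw [this, lintegral_indicator_one A.2]
    rfl

lemma exists_prod_expNegEval_sum {𝕏 : Type*} [MeasurableSpace 𝕏]
    (l : List ({A : Set 𝕏 // MeasurableSet A} ⊕ {A : Set 𝕏 // MeasurableSet A})) :
    ∃ l₁ l₂ : List {A : Set 𝕏 // MeasurableSet A}, ∀ m₁ m₂ : Measure 𝕏,
      (l.map fun i => ((Sum.elim (expNegEval m₁) (expNegEval m₂) i : unitInterval) : ℝ)).prod =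
        (l₁.map fun A => (expNegEval m₁ A : ℝ)).prod *
          (l₂.map fun A => (expNegEval m₂ A : ℝ)).prod := by
  induction l with
  | nil => exact ⟨[], [], by simp⟩
  | cons A l ih =>
    obtain ⟨l₁, l₂, h⟩ := ih
    rcases A with A | A
    · exact ⟨A :: l₁, l₂, fun m₁ m₂ => by
        rw [List.map_cons, List.prod_cons, h]; simp [mul_assoc]⟩
    · exact ⟨l₁, A :: l₂, fun m₁ m₂ => by
        rw [List.map_cons, List.prod_cons, h]; simp [mul_left_comm]⟩

lemma measurable_lintegral_ofReal {𝕏 : Type*} [MeasurableSpace 𝕏] {f : 𝕏 → ℝ} (hf : Measurable f) :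
    Measurable fun m : Measure 𝕏 => ∫⁻ x, ENNReal.ofReal (f x) ∂m :=
  Measure.measurable_lintegral hf.ennreal_ofReal

/-- A family of laws of random measures depends measurably on the parameter if their Laplace
functionals do. -/
lemma measurable_of_laplace {T 𝕏 : Type*} [MeasurableSpace T] [MeasurableSpace 𝕏]
    (ρ : T → Measure (Measure 𝕏)) [∀ t, IsProbabilityMeasure (ρ t)]
    (h : ∀ f : 𝕏 → ℝ, Measurable f → (∀ x, 0 ≤ f x) →
      Measurable fun t => ∫⁻ m, expNeg (∫⁻ x, ENNReal.ofReal (f x) ∂m) ∂(ρ t)) :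
    Measurable ρ := by
  refine measurable_measure_of_monomials expNegEval measurable_expNegEval
    measurableSpace_measure_le_comap_expNegEval ρ fun l => ?_
  obtain ⟨f, hf, hf0, hl⟩ := exists_prod_expNegEval l
  simp_rw [hl]
  convert (h f hf hf0).ennreal_toReal using 2 with t
  exact integral_toReal (measurable_expNeg.comp (measurable_lintegral_ofReal hf)).aemeasurable
    (Filter.Eventually.of_forall fun m => (expNeg_ne_top _).lt_top)

/-- The values of a pair of measures on measurable sets, transformed by `expNeg`. -/
def expNegEvalPair {𝕏 : Type*} [MeasurableSpace 𝕏] (p : Measure 𝕏 × Measure 𝕏)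
    (i : {A : Set 𝕏 // MeasurableSet A} ⊕ {A : Set 𝕏 // MeasurableSet A}) : unitInterval :=
  Sum.elim (expNegEval p.1) (expNegEval p.2) i

lemma measurable_expNegEvalPair {𝕏 : Type*} [MeasurableSpace 𝕏] :
    Measurable (expNegEvalPair (𝕏 := 𝕏)) := by
  refine measurable_pi_iff.2 fun i => ?_
  rcases i with A | A
  · exact ((measurable_pi_apply A).comp measurable_expNegEval).comp measurable_fst
  · exact ((measurable_pi_apply A).comp measurable_expNegEval).comp measurable_snd

lemma measurableSpace_prod_le_comap_expNegEvalPair {𝕏 : Type*} [MeasurableSpace 𝕏] :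
    (inferInstance : MeasurableSpace (Measure 𝕏 × Measure 𝕏)) ≤
      MeasurableSpace.comap (expNegEvalPair (𝕏 := 𝕏)) inferInstance := by
  have h := @comap_measurable _ _ inferInstance (expNegEvalPair (𝕏 := 𝕏))
  refine sup_le ?_ ?_
  · refine (MeasurableSpace.comap_mono measurableSpace_measure_le_comap_expNegEval).trans ?_
    rw [MeasurableSpace.comap_comp]
    exact Measurable.comap_le <| @measurable_pi_lambda _ _ _ (_) _ _ fun A =>
      (measurable_pi_apply (Sum.inl A)).comp h
  · refine (MeasurableSpace.comap_mono measurableSpace_measure_le_comap_expNegEval).trans ?_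
    rw [MeasurableSpace.comap_comp]
    exact Measurable.comap_le <| @measurable_pi_lambda _ _ _ (_) _ _ fun A =>
      (measurable_pi_apply (Sum.inr A)).comp h

/-- Joint laws of two random measures agree if their Laplace functionals do. -/
lemma measure_prod_eq_of_laplace {𝕏 : Type*} [MeasurableSpace 𝕏]
    (μ ν : Measure (Measure 𝕏 × Measure 𝕏)) [IsProbabilityMeasure μ] [IsProbabilityMeasure ν]
    (h : ∀ s f : 𝕏 → ℝ, Measurable s → (∀ x, 0 ≤ s x) → Measurable f → (∀ x, 0 ≤ f x) →
      ∫⁻ p, expNeg (∫⁻ x, ENNReal.ofReal (s x) ∂p.1) *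
          expNeg (∫⁻ x, ENNReal.ofReal (f x) ∂p.2) ∂μ =
        ∫⁻ p, expNeg (∫⁻ x, ENNReal.ofReal (s x) ∂p.1) *
          expNeg (∫⁻ x, ENNReal.ofReal (f x) ∂p.2) ∂ν) :
    μ = ν := by
  refine measure_eq_of_monomials expNegEvalPair measurable_expNegEvalPair
    measurableSpace_prod_le_comap_expNegEvalPair μ ν fun l => ?_
  · obtain ⟨l₁, l₂, hl⟩ := exists_prod_expNegEval_sum l
    obtain ⟨s, hs, hs0, h₁⟩ := exists_prod_expNegEval l₁
    obtain ⟨f, hf, hf0, h₂⟩ := exists_prod_expNegEval l₂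
    simp_rw [expNegEvalPair, hl, h₁, h₂, ← ENNReal.toReal_mul]
    have hm : Measurable fun p : Measure 𝕏 × Measure 𝕏 =>
        expNeg (∫⁻ x, ENNReal.ofReal (s x) ∂p.1) * expNeg (∫⁻ x, ENNReal.ofReal (f x) ∂p.2) :=
      (measurable_expNeg.comp ((measurable_lintegral_ofReal hs).comp measurable_fst)).mul
        (measurable_expNeg.comp ((measurable_lintegral_ofReal hf).comp measurable_snd))
    have hfin : ∀ p : Measure 𝕏 × Measure 𝕏, expNeg (∫⁻ x, ENNReal.ofReal (s x) ∂p.1) *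
        expNeg (∫⁻ x, ENNReal.ofReal (f x) ∂p.2) < ∞ := fun p =>
      (ENNReal.mul_ne_top (expNeg_ne_top _) (expNeg_ne_top _)).lt_top
    rw [integral_toReal hm.aemeasurable (Filter.Eventually.of_forall hfin),
      integral_toReal hm.aemeasurable (Filter.Eventually.of_forall hfin), h s f hs hs0 hf hf0]

/-! ### Laplace transforms of the Poisson and gamma laws and of the gamma Lévy measure. -/

lemma one_sub_expNeg_ofReal {x : ℝ} (hx : 0 ≤ x) :
    1 - expNeg (ENNReal.ofReal x) = ENNReal.ofReal (1 - Real.exp (-x)) := by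
  rw [expNeg_ofReal hx, ENNReal.ofReal_sub _ (Real.exp_nonneg _), ENNReal.ofReal_one]

/-- The exponential series evaluates the Poisson generating function at `z = e^{-c}`; `c = ∞` is
covered as `z = 0`. -/
lemma lintegral_poissonMeasure_expNeg (r : ℝ≥0) (c : ℝ≥0∞) :
    ∫⁻ n : ℕ, expNeg (n * c) ∂(poissonMeasure r) = expNeg (r * (1 - expNeg c)) := by
  set z : ℝ := (expNeg c).toReal with hz
  have hz0 : 0 ≤ z := ENNReal.toReal_nonneg
  have hz1 : z ≤ 1 := ENNReal.toReal_le_of_le_ofReal zero_le_one (by simpa using expNeg_le_one c)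
  have hzc : expNeg c = ENNReal.ofReal z := (ENNReal.ofReal_toReal (expNeg_ne_top c)).symm
  have hs : HasSum (fun n : ℕ => Real.exp (-r) * ((r * z) ^ n / n.factorial))
      (Real.exp (-r) * Real.exp (r * z)) := by
    refine HasSum.mul_left _ ?_
    rw [Real.exp_eq_exp_ℝ]
    exact NormedSpace.expSeries_div_hasSum_exp (r * z : ℝ)
  rw [poissonMeasure, lintegral_sum_measure]
  simp_rw [lintegral_smul_measure, lintegral_dirac, expNeg_natCast_mul, hzc]
  have : ∀ n : ℕ, ENNReal.ofReal (Real.exp (-r) * r ^ n / n.factorial) • ENNReal.ofReal z ^ n =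
      ENNReal.ofReal (Real.exp (-r) * ((r * z) ^ n / n.factorial)) := by
    intro n
    rw [smul_eq_mul, ← ENNReal.ofReal_pow hz0, ← ENNReal.ofReal_mul (by positivity)]
    congr 1
    rw [mul_pow]
    ring
  simp_rw [this]
  rw [← ENNReal.ofReal_tsum_of_nonneg (fun n => by positivity) hs.summable, hs.tsum_eq,
    ← ENNReal.ofReal_one, ← ENNReal.ofReal_sub _ hz0, ← ENNReal.ofReal_coe_nnreal,
    ← ENNReal.ofReal_mul r.coe_nonneg, expNeg_ofReal, ← Real.exp_add]
  · congr 2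
    ring
  · exact mul_nonneg r.coe_nonneg (by linarith)

lemma isProbabilityMeasure_gammaLaw {a r : ℝ} (ha : 0 ≤ a) (hr : 0 < r) :
    IsProbabilityMeasure (gammaLaw a r) := by
  unfold gammaLaw
  split_ifs with h
  · infer_instance
  · exact isProbabilityMeasure_gammaMeasure (ha.lt_of_ne' h) hr

/-- For `a > 0`, tilting the gamma density by `e^{-θw}` gives `(r/(r+θ))^a` times the gamma density
of rate `r + θ`, which has mass one. -/
lemma lintegral_gammaLaw_expNeg {a r θ : ℝ} (ha : 0 ≤ a) (hr : 0 < r) (hθ : 0 ≤ θ) :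
    ∫⁻ w, expNeg (ENNReal.ofReal w * ENNReal.ofReal θ) ∂(gammaLaw a r) =
      expNeg (ENNReal.ofReal (a * Real.log (1 + θ / r))) := by
  have h1 : 1 ≤ 1 + θ / r := by
    have : 0 ≤ θ / r := by positivity
    linarith
  have hlog : 0 ≤ a * Real.log (1 + θ / r) := mul_nonneg ha (Real.log_nonneg h1)
  rcases ha.eq_or_lt with rfl | ha'
  · rw [gammaLaw, if_pos rfl, lintegral_dirac]
    simp
  rw [gammaLaw, if_neg ha'.ne', gammaMeasure, expNeg_ofReal hlog]
  have hm : ∀ a r, Measurable (gammaPDF a r) := fun a r =>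
    (measurable_gammaPDFReal a r).ennreal_ofReal
  rw [lintegral_withDensity_eq_lintegral_mul _ (hm a r) (by fun_prop)]
  have : ∀ w, (gammaPDF a r * fun w => expNeg (ENNReal.ofReal w * ENNReal.ofReal θ)) w =
      ENNReal.ofReal (Real.exp (-(a * Real.log (1 + θ / r)))) * gammaPDF a (r + θ) w := by
    intro w
    rw [Pi.mul_apply]
    rcases lt_or_ge w 0 with hw | hw
    · rw [gammaPDF_of_neg hw, gammaPDF_of_neg hw, zero_mul, mul_zero]
    · rw [gammaPDF_of_nonneg hw, gammaPDF_of_nonneg hw, ← ENNReal.ofReal_mul hw,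
        expNeg_ofReal (by positivity), ← ENNReal.ofReal_mul (by
          have := Real.Gamma_pos_of_pos ha'
          positivity), ← ENNReal.ofReal_mul (Real.exp_nonneg _)]
      congr 1
      have hrθ : 0 < r + θ := by positivity
      have e1 : Real.exp (-(a * Real.log (1 + θ / r))) * (r + θ) ^ a = r ^ a := by
        have : 1 + θ / r = (r + θ) / r := by field_simp
        rw [this, Real.log_div hrθ.ne' hr.ne', Real.rpow_def_of_pos hrθ, Real.rpow_def_of_pos hr,
          ← Real.exp_add]
        congr 1
        ring
      have e2 : Real.exp (-((r + θ) * w)) = Real.exp (-(r * w)) * Real.exp (-(w * θ)) := by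
        rw [← Real.exp_add]
        congr 1
        ring
      rw [← e1, e2]
      ring
  simp_rw [this]
  rw [lintegral_const_mul _ (hm _ _), lintegral_gammaPDF_eq_one ha' (by positivity), mul_one]

instance sigmaFinite_gammaLevyMeasure (α τ : ℝ) : SigmaFinite (gammaLevyMeasure α τ) := by
  unfold gammaLevyMeasure
  infer_instance

/-- The Laplace exponent of the gamma distribution as an integral over its Lévy measure. -/
lemma lintegral_gammaLevyMeasure {α τ θ : ℝ} (hα : 0 < α) (hτ : 0 < τ) (hθ : 0 ≤ θ) :
    ∫⁻ w, (1 - expNeg (ENNReal.ofReal w * ENNReal.ofReal θ)) ∂(gammaLevyMeasure α τ) =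
      ENNReal.ofReal (α * Real.log (1 + θ / τ)) := by
  -- Frullani's device: `w⁻¹(1 - e^{-θw})e^{-τw}` is the integral of `e^{-(u+τ)w}` over `0 < u ≤ θ`.
  -- Tonelli then leaves the integral of `α/(u+τ)`, a logarithm.
  have hcore : ∀ w ∈ Set.Ioi (0 : ℝ), ENNReal.ofReal (α * w⁻¹ * Real.exp (-(w * τ))) *
      (1 - expNeg (ENNReal.ofReal w * ENNReal.ofReal θ)) =
        ∫⁻ u in Set.Ioc 0 θ, ENNReal.ofReal (α * Real.exp (-(u + τ) * w)) := by
    intro w hw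
    have hw : 0 < w := hw
    rw [← ENNReal.ofReal_mul hw.le, one_sub_expNeg_ofReal (by positivity),
      ← ENNReal.ofReal_mul (by positivity), ← ofReal_integral_eq_lintegral_ofReal,
      ← intervalIntegral.integral_of_le hθ]
    · congr 1
      have hd : ∀ u ∈ Set.uIcc 0 θ, HasDerivAt (fun u => -(α * w⁻¹) * Real.exp (-(u + τ) * w))
          (α * Real.exp (-(u + τ) * w)) u := by
        intro u _
        have h1 : HasDerivAt (fun u => -(u + τ) * w) (-1 * w) u :=
          (((hasDerivAt_id u).add_const τ).neg).mul_const w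
        refine ((h1.exp).const_mul (-(α * w⁻¹))).congr_deriv ?_
        have : w⁻¹ * w = 1 := inv_mul_cancel₀ hw.ne'
        linear_combination α * Real.exp (-(u + τ) * w) * this
      rw [intervalIntegral.integral_eq_sub_of_hasDerivAt hd
        (Continuous.intervalIntegrable (by fun_prop) _ _)]
      have : Real.exp (-(θ + τ) * w) = Real.exp (-(w * θ)) * Real.exp (-(w * τ)) := by
        rw [← Real.exp_add]; congr 1; ring
      rw [this]
      have : Real.exp (-(0 + τ) * w) = Real.exp (-(w * τ)) := by congr 1; ring
      rw [this]
      ring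
    · exact (Continuous.integrableOn_Icc (by fun_prop)).mono_set Set.Ioc_subset_Icc_self
    · exact Filter.Eventually.of_forall fun u => by positivity
  rw [gammaLevyMeasure, lintegral_withDensity_eq_lintegral_mul _ (by fun_prop) (by fun_prop)]
  simp only [Pi.mul_apply]
  rw [setLIntegral_congr_fun measurableSet_Ioi hcore, lintegral_lintegral_swap (by fun_prop)]
  have hin : ∀ u ∈ Set.Ioc 0 θ, ∫⁻ w in Set.Ioi (0 : ℝ), ENNReal.ofReal (α * Real.exp (-(u + τ) * w))
      = ENNReal.ofReal (α * (u + τ)⁻¹) := by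
    intro u hu
    have huτ : -(u + τ) < 0 := by linarith [hu.1]
    rw [← ofReal_integral_eq_lintegral_ofReal, integral_const_mul, integral_exp_mul_Ioi huτ]
    · congr 1
      rw [mul_zero, Real.exp_zero, neg_div_neg_eq, one_div]
    · exact (integrableOn_exp_mul_Ioi huτ 0).const_mul α
    · exact Filter.Eventually.of_forall fun u => by positivity
  rw [setLIntegral_congr_fun measurableSet_Ioc hin]
  have hc : ContinuousOn (fun u => α * (u + τ)⁻¹) (Set.Icc 0 θ) := by
    refine ContinuousOn.mul continuousOn_const (ContinuousOn.inv₀ (by fun_prop) ?_)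
    intro u hu
    linarith [hu.1]
  rw [← ofReal_integral_eq_lintegral_ofReal, ← intervalIntegral.integral_of_le hθ]
  · congr 1
    have hd : ∀ u ∈ Set.uIcc 0 θ, HasDerivAt (fun u => α * Real.log (u + τ))
        (α * (u + τ)⁻¹) u := by
      intro u hu
      rw [Set.uIcc_of_le hθ] at hu
      have : u + τ ≠ 0 := by linarith [hu.1]
      refine (((hasDerivAt_id u).add_const τ).log this |>.const_mul α).congr_deriv ?_
      rw [one_div]
      rfl
    rw [intervalIntegral.integral_eq_sub_of_hasDerivAt hd
      (ContinuousOn.intervalIntegrable_of_Icc hθ hc), zero_add, ← mul_sub,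
      ← Real.log_div (by positivity) hτ.ne']
    congr 2
    field_simp
    ring
  · exact (hc.integrableOn_Icc).mono_set Set.Ioc_subset_Icc_self
  · refine (ae_restrict_iff' measurableSet_Ioc).2 (Filter.Eventually.of_forall fun u hu => ?_)
    have : 0 < u := hu.1
    positivity

/-! ### Laplace functionals of Poisson and gamma processes. -/

lemma IsPoissonProcess.lintegral_expNeg_mul {Ω E : Type*} [MeasurableSpace Ω] [MeasurableSpace E]
    {N : Ω → Measure E} {Λ : Measure E} {P : Measure Ω} (h : IsPoissonProcess N Λ P)
    {A : Set E} (hA : MeasurableSet A) (hΛ : Λ A ≠ ∞) (y : ℝ≥0∞) :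
    ∫⁻ ω, expNeg (y * N ω A) ∂P = expNeg ((1 - expNeg y) * Λ A) := by
  have hN : Measurable fun ω => N ω A := (Measure.measurable_coe hA).comp h.measurable
  have hk : Measurable fun t : ℝ≥0∞ => expNeg (y * t) := by fun_prop
  rw [← lintegral_map (f := fun t => expNeg (y * t)) hk hN, h.law A hA hΛ,
    lintegral_map hk (by fun_prop)]
  simp_rw [mul_comm y]
  rw [lintegral_poissonMeasure_expNeg, ENNReal.coe_toNNReal hΛ, mul_comm]

/-- Counts on the disjoint level sets are independent Poisson, so the expectation factors. The level
set of `0` contributes the factor `1` and may have infinite intensity. -/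
lemma IsPoissonProcess.laplace_simpleFunc {Ω E : Type*} [MeasurableSpace Ω] [MeasurableSpace E]
    {N : Ω → Measure E} {Λ : Measure E} {P : Measure Ω} [IsProbabilityMeasure P]
    (h : IsPoissonProcess N Λ P) (g : SimpleFunc E ℝ≥0∞)
    (hΛ : ∀ y ≠ 0, Λ (g ⁻¹' {y}) ≠ ∞) :
    ∫⁻ ω, expNeg (∫⁻ x, g x ∂(N ω)) ∂P = expNeg (∫⁻ x, (1 - expNeg (g x)) ∂Λ) := by
  let e := g.range.equivFin
  let y : Fin g.range.card → ℝ≥0∞ := fun i => (e.symm i : ℝ≥0∞)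
  have hy : Function.Injective y := Subtype.val_injective.comp e.symm.injective
  let A : Fin g.range.card → Set E := fun i => g ⁻¹' {y i}
  have hA : ∀ i, MeasurableSet (A i) := fun i => g.measurableSet_fiber _
  have hsum : ∀ F : ℝ≥0∞ → ℝ≥0∞, ∑ t ∈ g.range, F t = ∑ i, F (y i) := fun F =>
    (Finset.sum_coe_sort g.range F).symm.trans (Equiv.sum_comp e.symm fun t => F (t : ℝ≥0∞)).symm
  have hdisj : Pairwise fun i j => Disjoint (A i) (A j) := fun i j hij => by
    refine Disjoint.preimage _ ?_
    rw [Set.disjoint_singleton]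
    exact fun h => hij (hy h)
  have hind : iIndepFun (fun i ω => expNeg (y i * N ω (A i))) P :=
    (h.indep _ A hA hdisj).comp (fun i t => expNeg (y i * t)) (fun i => by fun_prop)
  have hR : ∫⁻ x, (1 - expNeg (g x)) ∂Λ = ∑ i, (1 - expNeg (y i)) * Λ (A i) := by
    have := SimpleFunc.map_lintegral (fun t => 1 - expNeg t) g (μ := Λ)
    rw [← SimpleFunc.lintegral_eq_lintegral] at this
    rw [← hsum fun t => (1 - expNeg t) * Λ (g ⁻¹' {t}), ← this]
    rfl
  have hL : ∀ ω, ∫⁻ x, g x ∂(N ω) = ∑ i, y i * N ω (A i) := fun ω => by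
    rw [SimpleFunc.lintegral_eq_lintegral, SimpleFunc.lintegral,
      hsum fun t => t * N ω (g ⁻¹' {t})]
  simp_rw [hL, hR, expNeg_sum]
  rw [lintegral_prod_eq_prod_lintegral_of_indepFun _ _ hind (fun i => by
    have : Measurable fun ω => N ω (A i) := (Measure.measurable_coe (hA i)).comp h.measurable
    fun_prop)]
  refine Finset.prod_congr rfl fun i _ => ?_
  by_cases hi : y i = 0
  · simp [hi]
  · exact h.lintegral_expNeg_mul (hA i) (hΛ _ hi) (y i)

/-- The Laplace functional of a Poisson process. -/
theorem IsPoissonProcess.laplace {Ω E : Type*} [MeasurableSpace Ω] [MeasurableSpace E]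
    {N : Ω → Measure E} {Λ : Measure E} {P : Measure Ω} [IsProbabilityMeasure P] [SigmaFinite Λ]
    (h : IsPoissonProcess N Λ P) {g : E → ℝ≥0∞} (hg : Measurable g) :
    ∫⁻ ω, expNeg (∫⁻ x, g x ∂(N ω)) ∂P = expNeg (∫⁻ x, (1 - expNeg (g x)) ∂Λ) := by
  let S := spanningSets Λ
  have hS : ∀ n, MeasurableSet (S n) := measurableSet_spanningSets Λ
  -- Cutting off to spanning sets gives nonzero level sets of finite intensity, the only sets on
  -- which the law of the counts is prescribed.
  let u : ℕ → SimpleFunc E ℝ≥0∞ := fun n => (SimpleFunc.eapprox g n).restrict (S n)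
  have hu : ∀ n x, u n x = (S n).indicator (SimpleFunc.eapprox g n) x := fun n x => by
    rw [SimpleFunc.coe_restrict _ (hS n)]
  have hmono : ∀ x, Monotone fun n => u n x := fun x n m hnm => by
    simp only [hu]
    refine (Set.indicator_le_indicator_of_subset (monotone_spanningSets Λ hnm)
      (fun _ => zero_le) x).trans ?_
    exact Set.indicator_le_indicator (SimpleFunc.monotone_eapprox g hnm x)
  have hlim : ∀ x, Filter.Tendsto (fun n => u n x) Filter.atTop (nhds (g x)) := fun x => by
    refine (SimpleFunc.tendsto_eapprox hg x).congr' ?_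
    filter_upwards [eventually_mem_spanningSets Λ x] with n hn
    rw [hu, Set.indicator_of_mem hn]
  have hfin : ∀ n, ∀ y ≠ 0, Λ (u n ⁻¹' {y}) ≠ ∞ := fun n y hy => by
    refine ((measure_mono fun x hx => ?_).trans_lt (measure_spanningSets_lt_top Λ n)).ne
    by_contra hxS
    have : u n x = y := hx
    rw [hu, Set.indicator_of_notMem hxS] at this
    exact hy this.symm
  have hint : ∀ ω, Filter.Tendsto (fun n => expNeg (∫⁻ x, u n x ∂(N ω))) Filter.atTop
      (nhds (expNeg (∫⁻ x, g x ∂(N ω)))) := fun ω =>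
    (continuous_expNeg.tendsto _).comp <| lintegral_tendsto_of_tendsto_of_monotone
      (fun n => (u n).measurable.aemeasurable) (Filter.Eventually.of_forall hmono)
      (Filter.Eventually.of_forall hlim)
  have hleft := tendsto_lintegral_of_dominated_convergence (μ := P)
    (F := fun n ω => expNeg (∫⁻ x, u n x ∂(N ω)))
    (f := fun ω => expNeg (∫⁻ x, g x ∂(N ω))) (fun _ => 1)
    (fun n => measurable_expNeg.comp ((Measure.measurable_lintegral (u n).measurable).comp
      h.measurable))
    (fun n => Filter.Eventually.of_forall fun ω => expNeg_le_one _) (by simp)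
    (Filter.Eventually.of_forall hint)
  have hright : Filter.Tendsto (fun n => expNeg (∫⁻ x, (1 - expNeg (u n x)) ∂Λ)) Filter.atTop
      (nhds (expNeg (∫⁻ x, (1 - expNeg (g x)) ∂Λ))) := by
    refine (continuous_expNeg.tendsto _).comp <| lintegral_tendsto_of_tendsto_of_monotone
      (fun n => by fun_prop)
      (Filter.Eventually.of_forall fun x n m hnm => ?_)
      (Filter.Eventually.of_forall fun x => ?_)
    · exact tsub_le_tsub_left (expNeg_antitone (hmono x hnm)) 1
    · exact ENNReal.Tendsto.sub tendsto_const_nhds ((continuous_expNeg.tendsto _).comp (hlim x))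
        (Or.inl ENNReal.one_ne_top)
  refine tendsto_nhds_unique hleft ?_
  simp_rw [fun n => h.laplace_simpleFunc (u n) (hfin n)]
  exact hright

lemma lintegral_atomicMeasure {𝕏 : Type*} [MeasurableSpace 𝕏] (w : ℕ → ℝ) (X : ℕ → 𝕏)
    {g : 𝕏 → ℝ≥0∞} (hg : Measurable g) :
    ∫⁻ x, g x ∂(atomicMeasure w X) = ∑' k, ENNReal.ofReal (w k) * g (X k) := by
  simp [atomicMeasure, lintegral_sum_measure, lintegral_dirac' _ hg]

lemma measurable_expNeg_lintegral {𝕏 : Type*} [MeasurableSpace 𝕏] {f : 𝕏 → ℝ} (hf : Measurable f) :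
    Measurable fun m : Measure 𝕏 => expNeg (∫⁻ x, ENNReal.ofReal (f x) ∂m) :=
  measurable_expNeg.comp (measurable_lintegral_ofReal hf)

/-- The Laplace functional of the gamma process. -/
theorem IsGammaProcessLaw.laplace {𝕏 : Type*} [MeasurableSpace 𝕏] {α τ : ℝ} {H : Measure 𝕏}
    [IsProbabilityMeasure H] {Q : Measure (Measure 𝕏)} (h : IsGammaProcessLaw α τ H Q)
    (hα : 0 < α) (hτ : 0 < τ) {f : 𝕏 → ℝ} (hf : Measurable f) (hf0 : ∀ x, 0 ≤ f x) :
    ∫⁻ m, expNeg (∫⁻ x, ENNReal.ofReal (f x) ∂m) ∂Q =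
      expNeg (∫⁻ x, ENNReal.ofReal (α * Real.log (1 + f x / τ)) ∂H) := by
  obtain ⟨ν, hν, hN, rfl⟩ := h
  have hfm : Measurable fun x => ENNReal.ofReal (f x) := hf.ennreal_ofReal
  have hm : Measurable fun p : (ℕ → ℝ) × (ℕ → 𝕏) =>
      expNeg (∫⁻ x, ENNReal.ofReal (f x) ∂(atomicMeasure p.1 p.2)) :=
    (measurable_expNeg_lintegral hf).comp measurable_atomicMeasure
  rw [lintegral_map (measurable_expNeg_lintegral hf) measurable_atomicMeasure, lintegral_prod _ hm.aemeasurable]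
  have hjoint : Measurable fun p : ℝ × 𝕏 =>
      expNeg (ENNReal.ofReal p.1 * ENNReal.ofReal (f p.2)) := by fun_prop
  -- Integrating out the iid atoms gives the product of the `L (w k)`, a Laplace functional of the
  -- mass process at `negLog ∘ L`.
  let L : ℝ → ℝ≥0∞ := fun u => ∫⁻ x, expNeg (ENNReal.ofReal u * ENNReal.ofReal (f x)) ∂H
  have hL : Measurable L := hjoint.lintegral_prod_right'
  have hL1 : ∀ u, L u ≤ 1 := fun u =>
    (lintegral_mono fun x => expNeg_le_one _).trans (by simp)
  have hinner : ∀ w : ℕ → ℝ, ∫⁻ X, expNeg (∫⁻ x, ENNReal.ofReal (f x) ∂(atomicMeasure w X))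
      ∂(Measure.infinitePi fun _ : ℕ => H) =
        expNeg (∫⁻ u, negLog (L u) ∂(Measure.sum fun k => Measure.dirac (w k))) := by
    intro w
    simp_rw [lintegral_atomicMeasure w _ hfm]
    rw [lintegral_infinitePi_expNeg_tsum (fun _ : ℕ => H)
      (fun k x => ENNReal.ofReal (w k) * ENNReal.ofReal (f x)) (fun k => by fun_prop),
      lintegral_sum_measure]
    simp_rw [lintegral_dirac]
    rfl
  simp_rw [hinner]
  rw [hN.laplace (g := fun u => negLog (L u)) (measurable_negLog.comp hL)]
  congr 1
  -- Since `H` has mass one, `1 - L u` is an average over `H`. The exponent becomes a double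
  -- integral over masses and atoms, and Tonelli isolates the Lévy integral.
  have hsub : ∀ u, 1 - expNeg (negLog (L u)) =
      ∫⁻ x, (1 - expNeg (ENNReal.ofReal u * ENNReal.ofReal (f x))) ∂H := by
    intro u
    rw [expNeg_negLog (hL1 u), lintegral_sub (by fun_prop)
      ((hL1 u).trans_lt ENNReal.one_lt_top).ne
      (Filter.Eventually.of_forall fun x => expNeg_le_one _)]
    simp [L]
  simp_rw [hsub]
  rw [lintegral_lintegral_swap (measurable_const.sub hjoint).aemeasurable]
  exact lintegral_congr fun x => lintegral_gammaLevyMeasure hα hτ (hf0 x)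

/-! ### Change of rate by dilation. -/

/-- The measure `dw/w` is scale invariant, so a dilation changes only the exponential rate. -/
lemma map_mul_gammaLevyMeasure {α τ r : ℝ} (hα : 0 < α) (hr : 0 < r) :
    (gammaLevyMeasure α (r * τ)).map (fun w => r * w) = gammaLevyMeasure α τ := by
  ext A hA
  have hpre : MeasurableSet ((fun w => r * w) ⁻¹' A) := measurable_const_mul r hA
  rw [Measure.map_apply (measurable_const_mul r) hA]
  unfold gammaLevyMeasure
  rw [withDensity_apply _ hpre, withDensity_apply _ hA,
    Measure.restrict_restrict hpre, Measure.restrict_restrict hA,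
    ← lintegral_indicator (hpre.inter measurableSet_Ioi),
    ← lintegral_indicator (hA.inter measurableSet_Ioi)]
  set F : ℝ → ℝ≥0∞ := (A ∩ Set.Ioi 0).indicator
    fun w => ENNReal.ofReal (α * w⁻¹ * Real.exp (-(w * τ))) with hF
  have hFm : Measurable F := Measurable.indicator (by fun_prop) (hA.inter measurableSet_Ioi)
  have hvol : ENNReal.ofReal r • (volume : Measure ℝ).map (fun w => r * w) = volume := by
    rw [Real.map_volume_mul_left hr.ne', smul_smul, abs_of_pos (inv_pos.2 hr),
      ← ENNReal.ofReal_mul hr.le, mul_inv_cancel₀ hr.ne', ENNReal.ofReal_one, one_smul]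
  conv_rhs => rw [← hvol]
  rw [lintegral_smul_measure, lintegral_map hFm (measurable_const_mul r), smul_eq_mul,
    ← lintegral_const_mul (f := fun w => F (r * w)) _ (hFm.comp (measurable_const_mul r))]
  refine lintegral_congr fun w => ?_
  by_cases hw : w ∈ (fun w => r * w) ⁻¹' A ∩ Set.Ioi 0
  · have hw0 : 0 < w := hw.2
    have hw' : r * w ∈ A ∩ Set.Ioi 0 := ⟨hw.1, mul_pos hr hw0⟩
    rw [hF, Set.indicator_of_mem hw, Set.indicator_of_mem hw', ← ENNReal.ofReal_mul hr.le]
    congr 1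
    have : w * (r * τ) = r * w * τ := by ring
    rw [this]
    field_simp
  · have hw' : r * w ∉ A ∩ Set.Ioi 0 := fun h =>
      hw ⟨h.1, (mul_pos_iff_of_pos_left hr).1 h.2⟩
    rw [hF, Set.indicator_of_notMem hw, Set.indicator_of_notMem hw', mul_zero]

/-- A gamma process law exists for all rates as soon as it exists for one rate. -/
theorem IsGammaProcessLaw.exists_rate {𝕏 : Type*} [MeasurableSpace 𝕏] {α τ τ' : ℝ} {H : Measure 𝕏}
    {Q : Measure (Measure 𝕏)} (h : IsGammaProcessLaw α τ H Q)
    (hα : 0 < α) (hτ : 0 < τ) (hτ' : 0 < τ') :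
    ∃ Q' : Measure (Measure 𝕏), IsGammaProcessLaw α τ' H Q' := by
  obtain ⟨ν, hν, hN, -⟩ := h
  -- Multiplying every mass by `r = τ/τ'` turns rate `τ` into rate `τ'`; the process properties are
  -- pulled back through preimages.
  obtain ⟨r, hr, rfl⟩ : ∃ r, 0 < r ∧ τ = r * τ' := ⟨τ / τ', by positivity, by field_simp⟩
  let S : (ℕ → ℝ) → ℕ → ℝ := fun w k => r * w k
  have hS : Measurable S := by fun_prop
  let N : (ℕ → ℝ) → Measure ℝ := fun w => Measure.sum fun k => Measure.dirac (w k)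
  have hNS : ∀ A, MeasurableSet A → ∀ w, N (S w) A = N w ((fun u => r * u) ⁻¹' A) := by
    intro A hA w
    have hpre : MeasurableSet ((fun u => r * u) ⁻¹' A) := measurable_const_mul r hA
    simp only [N, S, Measure.sum_apply _ hA, Measure.sum_apply _ hpre, Measure.dirac_apply' _ hA,
      Measure.dirac_apply' _ hpre]
    rfl
  have hNm : ∀ A, MeasurableSet A → Measurable fun w => N w A := fun A hA =>
    (Measure.measurable_coe hA).comp hN.measurable
  have hΛ : ∀ A, MeasurableSet A →
      gammaLevyMeasure α τ' A = gammaLevyMeasure α (r * τ') ((fun u => r * u) ⁻¹' A) := by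
    intro A hA
    rw [← map_mul_gammaLevyMeasure hα hr, Measure.map_apply (measurable_const_mul r) hA]
  refine ⟨_, ν.map S, Measure.isProbabilityMeasure_map hS.aemeasurable, ⟨hN.measurable, ?_, ?_⟩, rfl⟩
  · intro A hA hfin
    have hpre : MeasurableSet ((fun u => r * u) ⁻¹' A) := measurable_const_mul r hA
    rw [hΛ A hA] at hfin ⊢
    rw [← hN.law _ hpre hfin, Measure.map_map (hNm A hA) hS]
    congr 1
    funext w
    exact hNS A hA w
  · intro n A hA hdisj
    have hpre : ∀ i, MeasurableSet ((fun u => r * u) ⁻¹' A i) := fun i =>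
      measurable_const_mul r (hA i)
    have hind := hN.indep n (fun i => (fun u => r * u) ⁻¹' A i) hpre
      fun i j hij => (hdisj hij).preimage _
    rw [iIndepFun_iff_map_fun_eq_pi_map (fun i => (hNm _ (hpre i)).aemeasurable)] at hind
    have : IsProbabilityMeasure (ν.map S) := Measure.isProbabilityMeasure_map hS.aemeasurable
    rw [iIndepFun_iff_map_fun_eq_pi_map (fun i => (hNm _ (hA i)).aemeasurable),
      Measure.map_map (measurable_pi_iff.2 fun i => hNm _ (hA i)) hS]
    convert hind using 1
    · congr 1
      funext w i
      exact hNS _ (hA i) w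
    · congr 1
      funext i
      refine (Measure.map_map (hNm _ (hA i)) hS).trans ?_
      congr 1
      funext w
      exact hNS _ (hA i) w

/-! ### Kernels and conditionally Poisson counts. -/

lemma measurable_poissonMeasure : Measurable poissonMeasure := by
  refine Measure.measurable_of_measurable_coe _ fun A hA => ?_
  simp_rw [poissonMeasure, Measure.sum_apply _ hA, Measure.smul_apply]
  refine Measurable.tsum fun n => ?_
  simp_rw [smul_eq_mul]
  fun_prop

lemma measurable_infinitePi {T ι : Type*} {F : ι → Type*} [MeasurableSpace T]
    [∀ i, MeasurableSpace (F i)] (κ : ∀ i, T → Measure (F i))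
    [∀ i t, IsProbabilityMeasure (κ i t)] (hκ : ∀ i, Measurable (κ i)) :
    Measurable fun t => Measure.infinitePi fun i => κ i t := by
  refine Measurable.measure_of_isPiSystem_of_isProbabilityMeasure
    (generateFrom_squareCylinders (α := F)).symm
    (isPiSystem_squareCylinders (fun i => MeasurableSpace.isPiSystem_measurableSet)
      fun i => MeasurableSet.univ) ?_
  intro A hA
  obtain ⟨s, u, hu', rfl⟩ := hA
  have hu : ∀ i, MeasurableSet (u i) := fun i => hu' i trivial
  have : ∀ t, Measure.infinitePi (fun i => κ i t) ((s : Set ι).pi u) = ∏ i ∈ s, κ i t (u i) :=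
    fun t => Measure.infinitePi_pi _ fun i _ => hu i
  simp_rw [this]
  exact Finset.measurable_fun_prod s fun i _ => (Measure.measurable_coe (hu i)).comp (hκ i)

/-- A conditional law given by a kernel determines the joint law. -/
lemma IsCondLaw.map_prod_eq_compProd {Ω E F : Type*} [MeasurableSpace Ω] [mE : MeasurableSpace E]
    [MeasurableSpace F] {P : Measure Ω} [IsProbabilityMeasure P] {Z : Ω → E} (hZ : Measurable Z)
    {Y : Ω → F} (hY : Measurable Y) (κ : Kernel E F) [IsMarkovKernel κ]
    (h : IsCondLaw P (MeasurableSpace.comap Z mE) Y fun ω => κ (Z ω)) :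
    P.map (fun ω => (Z ω, Y ω)) = (P.map Z) ⊗ₘ κ := by
  have : IsProbabilityMeasure (P.map fun ω => (Z ω, Y ω)) :=
    Measure.isProbabilityMeasure_map (hZ.prodMk hY).aemeasurable
  have : IsProbabilityMeasure (P.map Z) := Measure.isProbabilityMeasure_map hZ.aemeasurable
  refine Measure.ext_prod fun {S B} hS hB => ?_
  have hκB : Measurable fun z => κ z B := Kernel.measurable_coe κ hB
  rw [Measure.map_apply (hZ.prodMk hY) (hS.prod hB), Measure.compProd_apply_prod hS hB,
    setLIntegral_map hS hκB hZ]
  have hYB : MeasurableSet (Y ⁻¹' B) := hY hB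
  have hint : Integrable ((Y ⁻¹' B).indicator fun _ => (1 : ℝ)) P :=
    (integrable_const _).indicator hYB
  have h1 := setIntegral_condExp hZ.comap_le hint (s := Z ⁻¹' S) ⟨S, hS, rfl⟩
  rw [setIntegral_congr_ae (g := fun ω => (κ (Z ω)).real B) (hZ hS)
    ((h.2 B hB).mono fun ω hω _ => hω), setIntegral_indicator hYB] at h1
  simp only [measureReal_def, integral_const, smul_eq_mul, mul_one, Measure.restrict_apply_univ] at h1
  rw [integral_toReal (f := fun ω => κ (Z ω) B) (hκB.comp hZ).aemeasurable
    (Filter.Eventually.of_forall fun ω => measure_lt_top _ _)] at h1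
  refine ((ENNReal.toReal_eq_toReal_iff' ?_ (measure_ne_top _ _)).1 h1).symm
  have hle : ∫⁻ ω in Z ⁻¹' S, κ (Z ω) B ∂P ≤ ∫⁻ _ in Z ⁻¹' S, 1 ∂P :=
    lintegral_mono fun ω => prob_le_one
  exact (hle.trans_lt (by simp)).ne

/-- The joint Laplace functional of a random measure and of conditionally Poisson counts. -/
lemma lintegral_expNeg_poisson_counts {Ω 𝕏 : Type*} [MeasurableSpace Ω] [MeasurableSpace 𝕏]
    (P : Measure Ω) [IsProbabilityMeasure P] {φ : ℝ} (hφ : 0 < φ)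
    (w : ℕ → Ω → ℝ) (hw : ∀ k, Measurable (w k))
    (X : ℕ → Ω → 𝕏) (hX : ∀ k, Measurable (X k))
    (c : ℕ → Ω → ℕ) (hc : ∀ k, Measurable (c k))
    (hcond : IsCondLaw P
      (MeasurableSpace.comap (fun ω => ((fun k => w k ω), (fun k => X k ω))) inferInstance)
      (fun ω k => c k ω)
      (fun ω => Measure.infinitePi (fun k => poissonMeasure (φ * w k ω).toNNReal)))
    {s f : 𝕏 → ℝ} (hs : Measurable s) (hs0 : ∀ x, 0 ≤ s x) (hf : Measurable f)
    (hf0 : ∀ x, 0 ≤ f x) :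
    ∫⁻ ω, expNeg (∫⁻ x, ENNReal.ofReal (s x)
          ∂(atomicMeasure (fun k => (c k ω : ℝ)) fun k => X k ω)) *
        expNeg (∫⁻ x, ENNReal.ofReal (f x) ∂(atomicMeasure (fun k => w k ω) fun k => X k ω)) ∂P =
      ∫⁻ ω, expNeg (∫⁻ x, ENNReal.ofReal (f x + φ * (1 - Real.exp (-(s x))))
        ∂(atomicMeasure (fun k => w k ω) fun k => X k ω)) ∂P := by
  let Z : Ω → (ℕ → ℝ) × (ℕ → 𝕏) := fun ω => (fun k => w k ω, fun k => X k ω)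
  have hZ : Measurable Z := by fun_prop
  have hcm : Measurable fun ω k => c k ω := by fun_prop
  let κ : Kernel ((ℕ → ℝ) × (ℕ → 𝕏)) (ℕ → ℕ) :=
    ⟨fun z => Measure.infinitePi fun k => poissonMeasure (φ * z.1 k).toNNReal,
      measurable_infinitePi (fun k (z : (ℕ → ℝ) × (ℕ → 𝕏)) => poissonMeasure (φ * z.1 k).toNNReal)
        fun k => measurable_poissonMeasure.comp (by fun_prop)⟩
  have hκ : IsMarkovKernel κ := ⟨fun z => by
    change IsProbabilityMeasure (Measure.infinitePi _)
    infer_instance⟩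
  have hjoint := IsCondLaw.map_prod_eq_compProd hZ hcm κ hcond
  have : IsProbabilityMeasure (P.map Z) := Measure.isProbabilityMeasure_map hZ.aemeasurable
  let Φ : ((ℕ → ℝ) × (ℕ → 𝕏)) × (ℕ → ℕ) → ℝ≥0∞ := fun q =>
    expNeg (∑' k, (q.2 k : ℝ≥0∞) * ENNReal.ofReal (s (q.1.2 k))) *
      expNeg (∑' k, ENNReal.ofReal (q.1.1 k) * ENNReal.ofReal (f (q.1.2 k)))
  have hΦ : Measurable Φ := by
    refine Measurable.mul (measurable_expNeg.comp (Measurable.tsum fun k => ?_))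
      (measurable_expNeg.comp (Measurable.tsum fun k => ?_)) <;> fun_prop
  -- With masses and atoms frozen, averaging over the counts replaces `s` by the extra test function
  -- `φ(1 - e^{-s})` against the masses.
  have hinner : ∀ z, ∫⁻ n, Φ (z, n) ∂(κ z) =
      expNeg (∑' k, ENNReal.ofReal (z.1 k) *
        ENNReal.ofReal (f (z.2 k) + φ * (1 - Real.exp (-(s (z.2 k)))))) := by
    intro z
    have h1 := lintegral_infinitePi_expNeg_tsum
      (fun k => poissonMeasure (φ * z.1 k).toNNReal)
      (fun k n => (n : ℝ≥0∞) * ENNReal.ofReal (s (z.2 k))) (fun k => by fun_prop)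
    simp_rw [lintegral_poissonMeasure_expNeg, negLog_expNeg] at h1
    have h0 : Measurable fun n : ℕ → ℕ =>
        expNeg (∑' k, (n k : ℝ≥0∞) * ENNReal.ofReal (s (z.2 k))) :=
      measurable_expNeg.comp (Measurable.tsum fun k => by fun_prop)
    have h2 : ∫⁻ n, Φ (z, n) ∂(κ z) =
        (∫⁻ n, expNeg (∑' k, (n k : ℝ≥0∞) * ENNReal.ofReal (s (z.2 k)))
          ∂(Measure.infinitePi fun k => poissonMeasure (φ * z.1 k).toNNReal)) *
        expNeg (∑' k, ENNReal.ofReal (z.1 k) * ENNReal.ofReal (f (z.2 k))) := by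
      have hz : κ z = Measure.infinitePi fun k => poissonMeasure (φ * z.1 k).toNNReal := rfl
      rw [hz]
      simp only [Φ]
      exact lintegral_mul_const _ h0
    rw [h2, h1, ← expNeg_add, ← ENNReal.tsum_add]
    congr 2
    funext k
    have he : 0 ≤ 1 - Real.exp (-(s (z.2 k))) := by
      have : Real.exp (-(s (z.2 k))) ≤ 1 := Real.exp_le_one_iff.2 (by linarith [hs0 (z.2 k)])
      linarith
    rw [one_sub_expNeg_ofReal (hs0 _), ENNReal.ofReal_add (hf0 _) (mul_nonneg hφ.le he),
      ENNReal.ofReal_mul hφ.le, mul_add, add_comm]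
    congr 1
    change ENNReal.ofReal (φ * z.1 k) * _ = _
    rw [ENNReal.ofReal_mul hφ.le]
    ring
  have hL : ∀ ω, expNeg (∫⁻ x, ENNReal.ofReal (s x)
          ∂(atomicMeasure (fun k => (c k ω : ℝ)) fun k => X k ω)) *
        expNeg (∫⁻ x, ENNReal.ofReal (f x) ∂(atomicMeasure (fun k => w k ω) fun k => X k ω)) =
      Φ (Z ω, fun k => c k ω) := fun ω => by
    rw [lintegral_atomicMeasure _ _ hs.ennreal_ofReal, lintegral_atomicMeasure _ _ hf.ennreal_ofReal]
    simp_rw [ENNReal.ofReal_natCast]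
    rfl
  have hR : ∀ ω, expNeg (∫⁻ x, ENNReal.ofReal (f x + φ * (1 - Real.exp (-(s x))))
        ∂(atomicMeasure (fun k => w k ω) fun k => X k ω)) = ∫⁻ n, Φ (Z ω, n) ∂(κ (Z ω)) := fun ω => by
    rw [lintegral_atomicMeasure _ _ (by fun_prop), hinner]
  simp_rw [hL, hR]
  rw [← lintegral_map (f := Φ) hΦ (hZ.prodMk hcm), hjoint, Measure.lintegral_compProd hΦ,
    lintegral_map hΦ.lintegral_kernel_prod_right' hZ]

/-! ### The posterior random measure and the conjugacy identity. -/

lemma IsGammaProcessLaw.isProbabilityMeasure {𝕏 : Type*} [MeasurableSpace 𝕏] {α τ : ℝ}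
    {H : Measure 𝕏} [IsProbabilityMeasure H] {Q : Measure (Measure 𝕏)}
    (h : IsGammaProcessLaw α τ H Q) : IsProbabilityMeasure Q := by
  obtain ⟨ν, hν, -, rfl⟩ := h
  exact Measure.isProbabilityMeasure_map measurable_atomicMeasure.aemeasurable

lemma measurable_add_atomicMeasure {𝕏 : Type*} [MeasurableSpace 𝕏] (X : ℕ → 𝕏) :
    Measurable fun p : Measure 𝕏 × (ℕ → ℝ) => p.1 + atomicMeasure p.2 X := by
  have h : Measurable fun p : Measure 𝕏 × (ℕ → ℝ) => atomicMeasure p.2 X :=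
    measurable_atomicMeasure.comp (f := fun p : Measure 𝕏 × (ℕ → ℝ) => (p.2, X))
      (measurable_snd.prodMk measurable_const)
  refine Measure.measurable_of_measurable_coe _ fun A hA => ?_
  exact ((Measure.measurable_coe hA).comp measurable_fst).add ((Measure.measurable_coe hA).comp h)

/-- The Laplace functional of the sum of a gamma process and independent gamma masses at fixed
atoms. -/
lemma IsGammaProcessLaw.laplace_add_fixed_atoms {𝕏 : Type*} [MeasurableSpace 𝕏] {α b : ℝ}
    {H : Measure 𝕏} [IsProbabilityMeasure H] {Q : Measure (Measure 𝕏)}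
    (h : IsGammaProcessLaw α b H Q) (hα : 0 < α) (hb : 0 < b) (c : ℕ → ℕ) (X : ℕ → 𝕏)
    {f : 𝕏 → ℝ} (hf : Measurable f) (hf0 : ∀ x, 0 ≤ f x) :
    ∫⁻ m, expNeg (∫⁻ x, ENNReal.ofReal (f x) ∂m)
        ∂((Q.prod (Measure.infinitePi fun k => gammaLaw (c k : ℝ) b)).map
          fun p => p.1 + atomicMeasure p.2 X) =
      expNeg (∫⁻ x, ENNReal.ofReal (α * Real.log (1 + f x / b)) ∂H) *
        expNeg (∫⁻ x, ENNReal.ofReal (Real.log (1 + f x / b))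
          ∂(atomicMeasure (fun k => (c k : ℝ)) X)) := by
  have hg : ∀ k, IsProbabilityMeasure (gammaLaw (c k : ℝ) b) := fun k =>
    isProbabilityMeasure_gammaLaw (Nat.cast_nonneg _) hb
  have hQ := h.isProbabilityMeasure
  rw [lintegral_map (measurable_expNeg_lintegral hf) (measurable_add_atomicMeasure X)]
  simp_rw [lintegral_add_measure, expNeg_add]
  rw [lintegral_prod_mul (f := fun m : Measure 𝕏 => expNeg (∫⁻ x, ENNReal.ofReal (f x) ∂m))
      (g := fun w : ℕ → ℝ => expNeg (∫⁻ x, ENNReal.ofReal (f x) ∂(atomicMeasure w X)))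
      (measurable_expNeg_lintegral hf).aemeasurable
      ((measurable_expNeg_lintegral hf).comp
        (measurable_atomicMeasure.comp (measurable_id.prodMk measurable_const))).aemeasurable,
    h.laplace hα hb hf hf0]
  congr 1
  simp_rw [lintegral_atomicMeasure _ X hf.ennreal_ofReal]
  rw [lintegral_infinitePi_expNeg_tsum (fun k => gammaLaw (c k : ℝ) b)
    (fun k u => ENNReal.ofReal u * ENNReal.ofReal (f (X k))) (fun k => by fun_prop),
    lintegral_atomicMeasure _ X (by fun_prop)]
  -- Each fixed atom contributes the exponent `c k * log (1 + f (X k) / b)`; the shape enters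
  -- linearly, so the sum is an integral against the count measure.
  simp_rw [lintegral_gammaLaw_expNeg (Nat.cast_nonneg _) hb (hf0 _), negLog_expNeg,
    ENNReal.ofReal_mul (Nat.cast_nonneg _)]

/-- Gamma–Poisson conjugacy at the level of Laplace exponents. -/
lemma log_gamma_poisson_conjugate {τ φ s t : ℝ} (hτ : 0 < τ) (hφ : 0 < φ) (hs : 0 ≤ s) (ht : 0 ≤ t) :
    Real.log (1 + (t + φ * (1 - Real.exp (-s))) / τ) =
      Real.log (1 + t / (τ + φ)) +
        Real.log (1 + (0 + φ * (1 - Real.exp (-(s + Real.log (1 + t / (τ + φ)))))) / τ) := by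
  have h1 : 0 < 1 + t / (τ + φ) := by positivity
  have he : Real.exp (-s) ≤ 1 := Real.exp_le_one_iff.2 (by linarith)
  have hE : Real.exp (-(s + Real.log (1 + t / (τ + φ)))) = Real.exp (-s) / (1 + t / (τ + φ)) := by
    rw [neg_add, Real.exp_add, Real.exp_neg (Real.log _), Real.exp_log h1]
    exact (div_eq_mul_inv _ _).symm
  have hE1 : Real.exp (-s) / (1 + t / (τ + φ)) ≤ 1 := by
    rw [div_le_one h1]
    have : 0 ≤ t / (τ + φ) := by positivity
    linarith
  have h2 : 0 < 1 + (0 + φ * (1 - Real.exp (-s) / (1 + t / (τ + φ)))) / τ := by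
    have : 0 ≤ (0 + φ * (1 - Real.exp (-s) / (1 + t / (τ + φ)))) / τ := by
      refine div_nonneg ?_ hτ.le
      rw [zero_add]
      exact mul_nonneg hφ.le (by linarith)
    linarith
  -- Both arguments of the logarithm now equal `(τ + φ + t - φ e^{-s})/τ`.
  rw [hE, ← Real.log_mul h1.ne' h2.ne']
  congr 1
  have : τ + φ + t ≠ 0 := by positivity
  field_simp
  ring

end

/-! ### The conditional law. -/

theorem proposition3 {Ω 𝕏 : Type*} [MeasurableSpace Ω] [MeasurableSpace 𝕏]
    (P : Measure Ω) [IsProbabilityMeasure P]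
    (H : Measure 𝕏) [IsProbabilityMeasure H]
    (α τ φ : ℝ) (hα : 0 < α) (hτ : 0 < τ) (hφ : 0 < φ)
    -- the gamma process and an enumeration of its atoms and their masses
    (G : Ω → Measure 𝕏) (hG : Measurable G) (hGlaw : IsGammaProcessLaw α τ H (P.map G))
    (w : ℕ → Ω → ℝ) (hw : ∀ k, Measurable (w k)) (hw0 : ∀ k ω, 0 ≤ w k ω)
    (X : ℕ → Ω → 𝕏) (hX : ∀ k, Measurable (X k))
    (hGrep : ∀ᵐ ω ∂P, G ω = atomicMeasure (fun k => w k ω) (fun k => X k ω))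
    -- the counts: conditionally independent Poisson variables given the masses and atoms
    (c : ℕ → Ω → ℕ) (hc : ∀ k, Measurable (c k))
    (hcond : IsCondLaw P
      (MeasurableSpace.comap (fun ω => ((fun k => w k ω), (fun k => X k ω))) inferInstance)
      (fun ω k => c k ω)
      (fun ω => Measure.infinitePi (fun k => poissonMeasure (φ * w k ω).toNNReal)))
    (C : Ω → Measure 𝕏)
    (hC : ∀ ω, C ω = atomicMeasure (fun k => (c k ω : ℝ)) (fun k => X k ω)) :
    (∃ Qstar : Measure (Measure 𝕏), IsGammaProcessLaw α (τ + φ) H Qstar) ∧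
    ∀ Qstar : Measure (Measure 𝕏), IsGammaProcessLaw α (τ + φ) H Qstar →
      -- the law of `G* + ∑ₖ w*ₖ δ_{Xₖ}` with `G*`, `w*₁`, `w*₂`, … independent
      IsCondLaw P (MeasurableSpace.comap C inferInstance) G
        (fun ω =>
          (Qstar.prod (Measure.infinitePi (fun k => gammaLaw (c k ω : ℝ) (τ + φ)))).map
            (fun p => p.1 + atomicMeasure p.2 (fun k => X k ω))) := by
  have hb : 0 < τ + φ := by positivity
  refine ⟨hGlaw.exists_rate hα hτ hb, fun Qstar hQstar => ?_⟩
  have hQ := hQstar.isProbabilityMeasure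
  set Q : Ω → Measure (Measure 𝕏) := fun ω =>
    (Qstar.prod (Measure.infinitePi (fun k => gammaLaw (c k ω : ℝ) (τ + φ)))).map
      (fun p => p.1 + atomicMeasure p.2 (fun k => X k ω))
  have hQprob : ∀ ω, IsProbabilityMeasure (Q ω) := fun ω => by
    have : ∀ k, IsProbabilityMeasure (gammaLaw (c k ω : ℝ) (τ + φ)) := fun k =>
      isProbabilityMeasure_gammaLaw (Nat.cast_nonneg _) hb
    exact Measure.isProbabilityMeasure_map (measurable_add_atomicMeasure _).aemeasurable
  have hCm : Measurable C := by
    rw [funext hC]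
    exact measurable_atomicMeasure.comp (f := fun ω => (fun k => (c k ω : ℝ), fun k => X k ω))
      (by fun_prop)
  have hlogm : ∀ {f : 𝕏 → ℝ}, Measurable f →
      Measurable fun x => Real.log (1 + f x / (τ + φ)) := fun hf => by fun_prop
  have hlog0 : ∀ {f : 𝕏 → ℝ}, (∀ x, 0 ≤ f x) → ∀ x, 0 ≤ Real.log (1 + f x / (τ + φ)) :=
    fun {f} hf0 x => Real.log_nonneg (by
      have : 0 ≤ f x / (τ + φ) := div_nonneg (hf0 x) hb.le
      linarith)
  have hQlap : ∀ {f : 𝕏 → ℝ}, Measurable f → (∀ x, 0 ≤ f x) → ∀ ω,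
      ∫⁻ m, expNeg (∫⁻ x, ENNReal.ofReal (f x) ∂m) ∂(Q ω) =
        expNeg (∫⁻ x, ENNReal.ofReal (α * Real.log (1 + f x / (τ + φ))) ∂H) *
          expNeg (∫⁻ x, ENNReal.ofReal (Real.log (1 + f x / (τ + φ))) ∂(C ω)) :=
    fun hf hf0 ω => by
      rw [hC ω]
      exact hQstar.laplace_add_fixed_atoms hα hb (fun k => c k ω) (fun k => X k ω) hf hf0
  -- `Q` is built from the labelled pairs `(c_k, X_k)`, but its Laplace functionals involve them
  -- only through `C`.
  have hQmC : Measurable[MeasurableSpace.comap C inferInstance] Q := by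
    refine @measurable_of_laplace Ω 𝕏 (MeasurableSpace.comap C inferInstance) _ Q _
      fun f hf hf0 => ?_
    simp_rw [hQlap hf hf0]
    exact ((measurable_expNeg_lintegral (hlogm hf)).comp (comap_measurable C)).const_mul _
  -- The kernel lives on `Ω`, which avoids factoring `Q` through `C`; the first coordinate is mapped
  -- to `C` afterwards.
  let κ : Kernel Ω (Measure 𝕏) := ⟨Q, hQmC.mono hCm.comap_le le_rfl⟩
  have hκ : IsMarkovKernel κ := ⟨hQprob⟩
  have hjointlap : ∀ {s f : 𝕏 → ℝ}, Measurable s → (∀ x, 0 ≤ s x) → Measurable f →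
      (∀ x, 0 ≤ f x) →
      ∫⁻ ω, expNeg (∫⁻ x, ENNReal.ofReal (s x) ∂(C ω)) *
          expNeg (∫⁻ x, ENNReal.ofReal (f x) ∂(G ω)) ∂P =
        expNeg (∫⁻ x, ENNReal.ofReal
          (α * Real.log (1 + (f x + φ * (1 - Real.exp (-(s x)))) / τ)) ∂H) := by
    intro s f hs hs0 hf hf0
    have hfs : Measurable fun x => f x + φ * (1 - Real.exp (-(s x))) := by fun_prop
    rw [← hGlaw.laplace hα hτ hfs, lintegral_map (measurable_expNeg_lintegral hfs) hG]
    · calc _ = ∫⁻ ω, expNeg (∫⁻ x, ENNReal.ofReal (s x)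
              ∂(atomicMeasure (fun k => (c k ω : ℝ)) fun k => X k ω)) *
            expNeg (∫⁻ x, ENNReal.ofReal (f x)
              ∂(atomicMeasure (fun k => w k ω) fun k => X k ω)) ∂P := by
            refine lintegral_congr_ae (hGrep.mono fun ω hω => ?_)
            simp only [hC ω, hω]
        _ = _ := lintegral_expNeg_poisson_counts P hφ w hw X hX c hc hcond hs hs0 hf hf0
        _ = _ := lintegral_congr_ae (hGrep.mono fun ω hω => by simp only [hω])
    · intro x
      have : Real.exp (-(s x)) ≤ 1 := Real.exp_le_one_iff.2 (by linarith [hs0 x])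
      exact add_nonneg (hf0 x) (mul_nonneg hφ.le (by linarith))
  have hpair : Measurable fun p : Ω × Measure 𝕏 => (C p.1, p.2) := by fun_prop
  have hjoint : P.map (fun ω => (C ω, G ω)) = (P ⊗ₘ κ).map fun p => (C p.1, p.2) := by
    have i1 : IsProbabilityMeasure (P.map fun ω => (C ω, G ω)) :=
      Measure.isProbabilityMeasure_map (hCm.prodMk hG).aemeasurable
    have i2 : IsProbabilityMeasure ((P ⊗ₘ κ).map fun p => (C p.1, p.2)) :=
      Measure.isProbabilityMeasure_map hpair.aemeasurable
    refine measure_prod_eq_of_laplace _ _ fun s f hs hs0 hf hf0 => ?_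
    have hm : Measurable fun p : Measure 𝕏 × Measure 𝕏 =>
        expNeg (∫⁻ x, ENNReal.ofReal (s x) ∂p.1) * expNeg (∫⁻ x, ENNReal.ofReal (f x) ∂p.2) :=
      ((measurable_expNeg_lintegral hs).comp measurable_fst).mul
        ((measurable_expNeg_lintegral hf).comp measurable_snd)
    have hm' : Measurable fun p : Ω × Measure 𝕏 =>
        expNeg (∫⁻ x, ENNReal.ofReal (s x) ∂(C p.1)) * expNeg (∫⁻ x, ENNReal.ofReal (f x) ∂p.2) :=
      hm.comp hpair
    rw [lintegral_map hm (hCm.prodMk hG), lintegral_map hm hpair,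
      Measure.lintegral_compProd hm', hjointlap hs hs0 hf hf0]
    have hsl : Measurable fun x => s x + Real.log (1 + f x / (τ + φ)) := hs.add (hlogm hf)
    have hsl0 : ∀ x, 0 ≤ s x + Real.log (1 + f x / (τ + φ)) := fun x =>
      add_nonneg (hs0 x) (hlog0 hf0 x)
    -- The factor with integrand `0` against `G` equals `1`. It puts the expression in the form of
    -- `hjointlap` with second test function `0`.
    have hin : ∀ ω, ∫⁻ m, expNeg (∫⁻ x, ENNReal.ofReal (s x) ∂(C ω)) *
          expNeg (∫⁻ x, ENNReal.ofReal (f x) ∂m) ∂(κ ω) =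
        expNeg (∫⁻ x, ENNReal.ofReal (α * Real.log (1 + f x / (τ + φ))) ∂H) *
          (expNeg (∫⁻ x, ENNReal.ofReal (s x + Real.log (1 + f x / (τ + φ))) ∂(C ω)) *
            expNeg (∫⁻ x, ENNReal.ofReal 0 ∂(G ω))) := by
      intro ω
      rw [lintegral_const_mul _ (measurable_expNeg_lintegral hf)]
      simp_rw [ENNReal.ofReal_add (hs0 _) (hlog0 hf0 _)]
      rw [lintegral_add_left hs.ennreal_ofReal, expNeg_add]
      refine (congrArg _ (hQlap hf hf0 ω)).trans ?_
      simp [mul_left_comm]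
    simp_rw [hin]
    rw [lintegral_const_mul' _ _ (expNeg_ne_top _),
      hjointlap (f := fun _ => 0) hsl hsl0 measurable_const fun _ => le_rfl, ← expNeg_add,
      ← lintegral_add_left (by fun_prop)]
    congr 1
    refine lintegral_congr fun x => ?_
    rw [← ENNReal.ofReal_add (mul_nonneg hα.le (hlog0 hf0 x)), ← mul_add,
      log_gamma_poisson_conjugate hτ hφ (hs0 x) (hf0 x)]
    refine mul_nonneg hα.le (Real.log_nonneg ?_)
    have : Real.exp (-(s x + Real.log (1 + f x / (τ + φ)))) ≤ 1 :=
      Real.exp_le_one_iff.2 (by linarith [hsl0 x])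
    have : 0 ≤ (0 + φ * (1 - Real.exp (-(s x + Real.log (1 + f x / (τ + φ)))))) / τ := by
      refine div_nonneg ?_ hτ.le
      rw [zero_add]
      exact mul_nonneg hφ.le (by linarith)
    linarith
  refine ⟨hQprob, fun B hB => ?_⟩
  have hQB : Measurable[MeasurableSpace.comap C inferInstance] fun ω => Q ω B :=
    (Measure.measurable_coe hB).comp hQmC
  have hQBm : Measurable fun ω => Q ω B := hQB.mono hCm.comap_le le_rfl
  have hQBint : Integrable (fun ω => (Q ω).real B) P :=
    Integrable.of_bound hQBm.ennreal_toReal.aestronglyMeasurable 1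
      (Filter.Eventually.of_forall fun ω => by
        rw [Real.norm_eq_abs, abs_of_nonneg measureReal_nonneg]
        exact measureReal_le_one)
  refine (ae_eq_condExp_of_forall_setIntegral_eq hCm.comap_le
    ((integrable_const (1 : ℝ)).indicator (hG hB)) (fun s _ _ => hQBint.integrableOn) ?_
    (@Measurable.ennreal_toReal _ (_) _ hQB).stronglyMeasurable.aestronglyMeasurable).symm
  rintro _ ⟨D, hD, rfl⟩ -
  -- Sets of `σ(C)` have the form `C ⁻¹' D`, so the joint law on the rectangle `D ×ˢ B` is exactly
  -- the integral identity characterising the conditional expectation.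
  have hDB := congrArg (fun M => M (D ×ˢ B)) hjoint
  have hpre : (fun p : Ω × Measure 𝕏 => (C p.1, p.2)) ⁻¹' (D ×ˢ B) = (C ⁻¹' D) ×ˢ B := rfl
  simp only [Measure.map_apply (hCm.prodMk hG) (hD.prod hB), Measure.map_apply hpair (hD.prod hB),
    hpre, Measure.compProd_apply_prod (hCm hD) hB] at hDB
  rw [setIntegral_indicator (hG hB)]
  simp only [measureReal_def, integral_const, smul_eq_mul, mul_one, Measure.restrict_apply_univ]
  rw [integral_toReal hQBm.aemeasurable
    (Filter.Eventually.of_forall fun ω => measure_lt_top _ _)]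
  exact congrArg ENNReal.toReal hDB.symm
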